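/- Let $\mathbb{k}$ be an algebraically closed field of characteristic zero, $G$ a finite abelian group, and $\Phi\colon G\times G\times G\to\mathbb{k}^*$ a normalized $3$-cocycle, that is, $$\Phi(ef,g,h)\,\Phi(e,f,gh)=\Phi(e,f,g)\,\Phi(e,fg,h)\,\Phi(f,g,h),\qquad \Phi(f,1,g)=1\qquad (e,f,g,h\in G).$$ Put $\Phi_g(x,y)=\Phi(g,x,y)\,\Phi(x,y,g)\,\Phi(x,g,y)^{-1}$. An object of the twisted Yetter–Drinfeld category ${}_{\mathbb{k}G}^{\mathbb{k}G}\mathcal{YD}^{\Phi}$ is a $G$-graded vector space $V=\bigoplus_{g\in G}V_g$ with linear operators $e\triangleright{-}$ $(e\in G)$ preserving every $V_g$ and satisfying $1\triangleright v=v$ and $e\triangleright(f\triangleright v)=\Phi_g(e,f)\,(ef)\triangleright v$ for $v\in V_g$. Its braiding is $\mathcal{R}(X\otimes Y)=(e\triangleright Y)\otimes X$ for $X\in V_e$, $Y\in V$. Subobjects are the graded subspaces stable under the action, with the induced structure; an object is simple if it is nonzero and has no nonzero proper subobject. A simple object $S$ satisfies $S=S_g$ for a unique $g\in G$, called its degree.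 An object $V$ is diagonal if it has a finite basis $X_1,\dots,X_n$ of homogeneous elements and scalars $q_{ij}\in\mathbb{k}^*$ with $\mathcal{R}(X_i\otimes X_j)=q_{ij}\,X_j\otimes X_i$ for all $1\le i,j\le n$, and nondiagonal otherwise. It is minimal nondiagonal if it is nondiagonal and each of its nonzero proper subobjects is diagonal. A normalized $3$-cocycle $\Psi$ on a finite abelian group $H$ is abelian if every simple object of ${}_{\mathbb{k}H}^{\mathbb{k}H}\mathcal{YD}^{\Psi}$ is one-dimensional, and nonabelian otherwise. **Proposition 5.4.** Let $V=V_1\oplus\cdots\oplus V_\theta$ be an object of ${}_{\mathbb{k}G}^{\mathbb{k}G}\mathcal{YD}^{\Phi}$ of rank $\theta$, i.e. a direct sum of $\theta$ simple subobjects, let $g_i$ be the degree of $V_i$, and let $G_V=\langle g_1,\dots,g_\theta\rangle$ be the support group of $V$. Then $V$ is minimal nondiagonal if and only if $\theta=3$ and the restriction $\Phi_{G_V}$ of $\Phi$ to $G_V$ is a nonabelian $3$-cocycle on $G_V$. -/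

import Mathlib

open scoped TensorProduct DirectSum

universe u v w

/-- A normalized `3`-cocycle on a group `G` with values in `kˣ` (trivial action). -/
structure NormalizedThreeCocycle (k : Type u) [Field k] (G : Type v) [CommGroup G] where
  toFun : G → G → G → kˣ
  cocycle : ∀ e f g h : G,
    toFun (e * f) g h * toFun e f (g * h) = toFun e f g * toFun e (f * g) h * toFun f g h
  normalized : ∀ f g : G, toFun f 1 g = 1

namespace NormalizedThreeCocycle

variable {k : Type u} [Field k] {G : Type v} [CommGroup G]

/-- The `2`-cocycle `Φ_g(x, y) = Φ(g, x, y) Φ(x, y, g) / Φ(x, g, y)`. -/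
def slant (Φ : NormalizedThreeCocycle k G) (g x y : G) : kˣ :=
  Φ.toFun g x y * Φ.toFun x y g / Φ.toFun x g y

/-- The restriction of a normalized `3`-cocycle to a subgroup. -/
def restrict (Φ : NormalizedThreeCocycle k G) (H : Subgroup G) : NormalizedThreeCocycle k H where
  toFun x y z := Φ.toFun x y z
  cocycle e f g h := Φ.cocycle e f g h
  normalized f g := Φ.normalized f g

end NormalizedThreeCocycle

open Classical in
/-- The structure of a twisted Yetter-Drinfeld module over `(kG, Φ)` on a vector space `V`:
a `G`-grading `V = ⨁ V_g` together with an action making each `V_g` a projective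
`G`-representation with respect to `Φ_g`. -/
structure TwistedYD {k : Type u} [Field k] {G : Type v} [CommGroup G]
    (Φ : NormalizedThreeCocycle k G) (V : Type w) [AddCommGroup V] [Module k V] where
  component : G → Submodule k V
  isInternal : DirectSum.IsInternal component
  act : G → V →ₗ[k] V
  act_mem : ∀ (e g : G) (x : V), x ∈ component g → act e x ∈ component g
  act_one : ∀ x : V, act 1 x = x
  act_act : ∀ (e f g : G) (x : V), x ∈ component g →
    act e (act f x) = ((Φ.slant g e f : kˣ) : k) • act (e * f) x

namespace TwistedYD

variable {k : Type u} [Field k] {G : Type v} [CommGroup G] {Φ : NormalizedThreeCocycle k G}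
  {V : Type w} [AddCommGroup V] [Module k V]

open Classical in
/-- The identification of `V` with the direct sum of its homogeneous components. -/
noncomputable def decompose (M : TwistedYD Φ V) : V ≃ₗ[k] ⨁ g, M.component g :=
  (LinearEquiv.ofBijective (DirectSum.coeLinearMap M.component) M.isInternal).symm

open Classical in
theorem decompose_of_mem (M : TwistedYD Φ V) {g : G} {x : V} (hx : x ∈ M.component g) :
    M.decompose x = DirectSum.lof k G (fun g => M.component g) g ⟨x, hx⟩ := by
  exact (LinearEquiv.symm_apply_eq _).2 (DirectSum.coeLinearMap_lof M.component g ⟨x, hx⟩).symm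

/-- The projection of `V` onto `V_g`, as an endomorphism of `V`. -/
noncomputable def proj (M : TwistedYD Φ V) (g : G) : V →ₗ[k] V :=
  (M.component g).subtype ∘ₗ DirectSum.component k G (fun g => M.component g) g ∘ₗ
    M.decompose.toLinearMap

open Classical in
/-- The braiding of `V` with itself; see `braiding_tmul` for the formula on homogeneous tensors. -/
noncomputable def braiding (M : TwistedYD Φ V) : V ⊗[k] V →ₗ[k] V ⊗[k] V :=
  TensorProduct.lift
    (DirectSum.toModule k G (V →ₗ[k] V ⊗[k] V)
      (fun g => LinearMap.lcomp k (V ⊗[k] V) (M.act g) ∘ₗ (TensorProduct.mk k V V).flip ∘ₗ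
        (M.component g).subtype) ∘ₗ M.decompose.toLinearMap)

/-- `R(X ⊗ Y) = (e ▷ Y) ⊗ X` for `X` of degree `e`. -/
theorem braiding_tmul (M : TwistedYD Φ V) {e : G} {x : V} (hx : x ∈ M.component e) (y : V) :
    M.braiding (x ⊗ₜ[k] y) = M.act e y ⊗ₜ[k] x := by
  classical
  rw [braiding, TensorProduct.lift.tmul, LinearMap.comp_apply, LinearEquiv.coe_coe,
    M.decompose_of_mem hx, DirectSum.toModule_lof]
  rfl

/-- `V` is of diagonal type: it has a finite basis of homogeneous elements with
`R(X_i ⊗ X_j) = q_ij X_j ⊗ X_i` for nonzero scalars `q_ij`. -/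
def IsDiagonal (M : TwistedYD Φ V) : Prop :=
  ∃ (n : ℕ) (X : Module.Basis (Fin n) k V) (q : Fin n → Fin n → kˣ),
    (∀ i, ∃ g, X i ∈ M.component g) ∧
      ∀ i j, M.braiding (X i ⊗ₜ[k] X j) = ((q i j : kˣ) : k) • (X j ⊗ₜ[k] X i)

/-- A subobject of `V`: a graded subspace stable under the action. -/
structure Subobject (M : TwistedYD Φ V) where
  carrier : Submodule k V
  proj_mem : ∀ (g : G) (x : V), x ∈ carrier → M.proj g x ∈ carrier
  act_mem : ∀ (e : G) (x : V), x ∈ carrier → M.act e x ∈ carrier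

open Classical in
theorem Subobject.isInternal {M : TwistedYD Φ V} (N : M.Subobject) :
    DirectSum.IsInternal fun g => (M.component g).comap N.carrier.subtype := by
  have hM := (DirectSum.isInternal_submodule_iff_iSupIndep_and_iSup_eq_top _).1 M.isInternal
  rw [DirectSum.isInternal_submodule_iff_iSupIndep_and_iSup_eq_top]
  refine ⟨?_, ?_⟩
  · rw [iSupIndep_def]
    intro g
    rw [Submodule.disjoint_def]
    intro x hx hx'
    have h := (Submodule.disjoint_def.1 (iSupIndep_def.1 hM.1 g)) (x : V) hx ?_
    · exact Subtype.ext h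
    · have h2 : (⨆ j, ⨆ (_ : j ≠ g), (M.component j).comap N.carrier.subtype) ≤
          (⨆ j, ⨆ (_ : j ≠ g), M.component j).comap N.carrier.subtype :=
        iSup₂_le fun j hj => Submodule.comap_mono (le_iSup₂_of_le j hj le_rfl)
      exact h2 hx'
  · rw [eq_top_iff]
    rintro x -
    have hx : (x : V) = ∑ g ∈ (M.decompose x).support, M.proj g x := by
      have h := congrArg (DirectSum.coeLinearMap M.component)
        (DirectSum.sum_support_of (M.decompose (x : V)))
      rw [map_sum] at h
      have h' : DirectSum.coeLinearMap M.component (M.decompose (x : V)) = x :=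
        M.decompose.symm_apply_apply _
      rw [h'] at h
      rw [← h]
      refine Finset.sum_congr (by rw [h]) fun g _ => ?_
      rw [h]
      exact DirectSum.coeLinearMap_lof _ _ _
    have hx' : x = ∑ g ∈ (M.decompose (x : V)).support,
        (⟨M.proj g x, N.proj_mem g x x.2⟩ : N.carrier) := by
      apply Subtype.ext
      rw [AddSubmonoidClass.coe_finsetSum]
      exact hx
    rw [hx']
    refine Submodule.sum_mem _ fun g _ => Submodule.mem_iSup_of_mem g ?_
    exact (DirectSum.component k G (fun g => M.component g) g (M.decompose x)).2

/-- A subobject, regarded as a twisted Yetter-Drinfeld module with the induced structure. -/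
def Subobject.obj {M : TwistedYD Φ V} (N : M.Subobject) : TwistedYD Φ N.carrier where
  component g := (M.component g).comap N.carrier.subtype
  isInternal := N.isInternal
  act e := (M.act e).restrict fun x hx => N.act_mem e x hx
  act_mem e g x hx := M.act_mem e g x hx
  act_one x := Subtype.ext (M.act_one x)
  act_act e f g x hx := Subtype.ext (M.act_act e f g x hx)

/-- `V` is simple: it is nonzero and has no subobjects other than `0` and `V`. -/
def IsSimple (M : TwistedYD Φ V) : Prop :=
  Nontrivial V ∧ ∀ N : M.Subobject, N.carrier = ⊥ ∨ N.carrier = ⊤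

/-- `V` is concentrated in degree `g`, that is `V = V_g`. -/
def HasDegree (M : TwistedYD Φ V) (g : G) : Prop :=
  M.component g = ⊤

open Classical in
/-- `V = S_1 ⊕ ⋯ ⊕ S_θ` is a decomposition of `V` into a direct sum of simple subobjects; an
object that has one is said to be of rank `θ`. -/
def IsSimpleDecomposition (M : TwistedYD Φ V) {θ : ℕ} (S : Fin θ → M.Subobject) : Prop :=
  (∀ i, (S i).obj.IsSimple) ∧ DirectSum.IsInternal fun i => (S i).carrier

/-- The support group of `V = S_1 ⊕ ⋯ ⊕ S_θ`: the subgroup generated by the degrees of the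
summands. -/
def supportGroup (M : TwistedYD Φ V) {θ : ℕ} (S : Fin θ → M.Subobject) : Subgroup G :=
  Subgroup.closure {g | ∃ i, (S i).obj.HasDegree g}

/-- `V` is minimal nondiagonal: it is not of diagonal type, but each nonzero proper subobject is. -/
def IsMinimalNondiagonal (M : TwistedYD Φ V) : Prop :=
  ¬ M.IsDiagonal ∧ ∀ N : M.Subobject, N.carrier ≠ ⊥ → N.carrier ≠ ⊤ → N.obj.IsDiagonal

end TwistedYD

/-- `Φ` is an abelian `3`-cocycle: every simple twisted Yetter-Drinfeld module over `(kG, Φ)` is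
one-dimensional. For finite `G` the simple objects are finite-dimensional, so up to isomorphism
all of them have their underlying space in the universe of `k`. -/
def NormalizedThreeCocycle.IsAbelian {k : Type u} [Field k] {G : Type v} [CommGroup G]
    (Φ : NormalizedThreeCocycle k G) : Prop :=
  ∀ (V : Type u) [AddCommGroup V] [Module k V] (M : TwistedYD Φ V),
    M.IsSimple → Module.finrank k V = 1

/-!
The whole question is governed by the antisymmetrization `alt` of the cocycle,
`alt Φ g e f = Φ_g(e, f) / Φ_g(f, e)`. It is a trimultiplicative (`alt_mul` together with the cyclic
symmetry `alt_cycle`) and alternating (`alt_self`) function `G × G × G → kˣ`, and it measures the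
failure of the operators `e ▷ -` and `f ▷ -` to commute on `V_g` (`TwistedYD.act_comm`). Two facts
translate both sides of the equivalence into conditions on `alt`.

* A finite-dimensional `V` is diagonal if and only if `alt g e f = 1` for all `g, e, f` in the
  support of `V` (`TwistedYD.isDiagonal_iff`). A diagonalizing basis consists of joint eigenvectors
  of the operators `e ▷ -` with `e` in the support, so these commute on every `V_g`. Conversely, on
  `V_g` each operator has a power that is a nonzero scalar, hence is semisimple, and commuting
  semisimple operators over an algebraically closed field have a basis of joint eigenvectors.
* `Φ` is abelian on a subgroup `H` if `alt` is trivial on `H`, by Schur's lemma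
  (`isAbelian_of_alt_eq_one`). If `alt g e f ≠ 1` with `g, e, f ∈ H` and `V_g ≠ 0`, then a minimal
  `H`-stable subspace of `V_g` is a simple object over `H` which is not a line
  (`IsAbelian.alt_eq_one`, `TwistedYD.alt_eq_one_of_isAbelian_restrict`).

By trimultiplicativity, `alt` is trivial on the support group as soon as it is trivial on the degrees
`g_1, …, g_θ`; so `V` is diagonal if and only if the restriction of `Φ` to the support group is
abelian. If `V` is nondiagonal, then `alt g_i g_j g_l ≠ 1` for some `i, j, l`, which are distinct since
`alt` is alternating. The subobject `V_i ⊕ V_j ⊕ V_l` is then nondiagonal, so it is all of `V` when `V`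
is minimal nondiagonal, whence `θ = 3`. Conversely, if `θ = 3` and a subobject `N` is nondiagonal, its
support contains three distinct degrees. Hence the `g_i` are distinct, `V_i` is the component of
degree `g_i`, and `N` meets each of the simple objects `V_i`, so that `N = V`.
-/

/-! ### The antisymmetrization of a three-cocycle -/

namespace NormalizedThreeCocycle

variable {k : Type u} [Field k] {G : Type v} [CommGroup G] (Φ : NormalizedThreeCocycle k G)

/-- The antisymmetrization of the `3`-cocycle `Φ`, written as the commutator pairing
`Φ_g(e, f) / Φ_g(f, e)` of the `2`-cocycle `Φ_g`. -/
def alt (g e f : G) : kˣ := Φ.slant g e f / Φ.slant g f e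

theorem alt_cycle (g e f : G) : Φ.alt g e f = Φ.alt e f g := by
  apply Additive.ofMul.injective
  simp only [alt, slant, ofMul_mul, ofMul_div]
  abel

theorem alt_self (g f : G) : Φ.alt g g f = 1 := by
  rw [alt, slant, slant, div_eq_one]
  simp only [div_eq_mul_inv]
  rw [mul_inv_cancel_comm, mul_assoc, mul_inv_cancel, mul_one]

/-- Multiplicativity in the first argument; by `alt_cycle` it holds in every argument. -/
theorem alt_mul (x y e f : G) : Φ.alt (x * y) e f = Φ.alt x e f * Φ.alt y e f := by
  apply Additive.ofMul.injective
  -- The alternating sum of the cocycle identities over those orderings of `x, y, e, f` in which `x`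
  -- precedes `y`, with the signs of the orderings. The terms that involve a product other than
  -- `x * y`, or both `x` and `y` as separate arguments, cancel in pairs.
  have c (a b c d : G) := congrArg Additive.ofMul (Φ.cocycle a b c d)
  have h1 := c x y e f
  have h2 := c x y f e
  have h3 := c x e y f
  have h4 := c x f y e
  have h5 := c x e f y
  have h6 := c x f e y
  have h7 := c e x y f
  have h8 := c f x y e
  have h9 := c e x f y
  have h10 := c f x e y
  have h11 := c e f x y
  have h12 := c f e x y
  simp only [mul_comm f e, mul_comm e x, mul_comm f x, mul_comm e y, mul_comm f y, alt, slant,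
    ofMul_mul, ofMul_div] at *
  linear_combination (norm := module) h1 - h2 - h3 + h4 + h5 - h6 + h7 - h8 - h9 + h10 + h11 - h12

theorem slant_eq_alt_mul (g e f : G) : Φ.slant g e f = Φ.alt g e f * Φ.slant g f e :=
  (div_mul_cancel _ _).symm

theorem alt_self_right (g e : G) : Φ.alt g e e = 1 := by
  rw [Φ.alt_cycle, Φ.alt_self]

theorem alt_self_outer (g e : G) : Φ.alt g e g = 1 := by
  rw [← Φ.alt_cycle, Φ.alt_self]

theorem alt_eq_one_of_mem_closure_left {s : Set G} {e f : G} (h : ∀ g ∈ s, Φ.alt g e f = 1)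
    {g : G} (hg : g ∈ Subgroup.closure s) : Φ.alt g e f = 1 := by
  let φ : G →* kˣ := MonoidHom.mk' (fun g => Φ.alt g e f) fun x y => Φ.alt_mul x y e f
  have : Subgroup.closure s ≤ φ.ker := (Subgroup.closure_le _).2 h
  exact this hg

theorem alt_eq_one_of_mem_closure {s : Set G}
    (h : ∀ g ∈ s, ∀ e ∈ s, ∀ f ∈ s, Φ.alt g e f = 1) {g e f : G}
    (hg : g ∈ Subgroup.closure s) (he : e ∈ Subgroup.closure s) (hf : f ∈ Subgroup.closure s) :
    Φ.alt g e f = 1 := by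
  refine Φ.alt_eq_one_of_mem_closure_left (fun g hg => ?_) hg
  rw [Φ.alt_cycle]
  refine Φ.alt_eq_one_of_mem_closure_left (fun e he => ?_) he
  rw [Φ.alt_cycle]
  refine Φ.alt_eq_one_of_mem_closure_left (fun f hf => ?_) hf
  rw [Φ.alt_cycle]
  exact h g hg e he f hf

variable {Φ} in
theorem ne_of_alt_ne_one {g e f : G} (h : Φ.alt g e f ≠ 1) : g ≠ e ∧ g ≠ f ∧ e ≠ f :=
  ⟨fun h' => h (h' ▸ Φ.alt_self _ _), fun h' => h (h' ▸ Φ.alt_self_outer _ _),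
    fun h' => h (h' ▸ Φ.alt_self_right _ _)⟩

end NormalizedThreeCocycle

/-! ### Homogeneous components and the action -/

namespace TwistedYD

variable {k : Type u} [Field k] {G : Type v} [CommGroup G] {Φ : NormalizedThreeCocycle k G}
  {V : Type w} [AddCommGroup V] [Module k V] (M : TwistedYD Φ V)

theorem iSup_component : ⨆ g, M.component g = ⊤ := by
  classical
  exact M.isInternal.submodule_iSup_eq_top

theorem hom_ext {W : Type*} [AddCommGroup W] [Module k W] {φ ψ : V →ₗ[k] W}
    (h : ∀ g, ∀ x ∈ M.component g, φ x = ψ x) : φ = ψ := by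
  rw [← LinearMap.eqLocus_eq_top, eq_top_iff, ← M.iSup_component]
  exact iSup_le h

theorem proj_mem (g : G) (x : V) : M.proj g x ∈ M.component g :=
  Subtype.property _

variable {M}

theorem proj_of_mem {g : G} {x : V} (hx : x ∈ M.component g) : M.proj g x = x := by
  classical
  simp [proj, M.decompose_of_mem hx, DirectSum.component.lof_self]

theorem proj_of_mem_ne {g h : G} {x : V} (hx : x ∈ M.component h) (hne : h ≠ g) :
    M.proj g x = 0 := by
  classical
  simp [proj, M.decompose_of_mem hx, DirectSum.component.of, hne]

theorem eq_of_mem_component {g h : G} {x : V} (hg : x ∈ M.component g) (hh : x ∈ M.component h)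
    (hx : x ≠ 0) : g = h := by
  by_contra hne
  exact hx ((proj_of_mem hg).symm.trans (proj_of_mem_ne hh (Ne.symm hne)))

theorem coe_obj_proj (N : M.Subobject) (g : G) (x : N.carrier) :
    (N.obj.proj g x : V) = M.proj g x := by
  have : N.carrier.subtype ∘ₗ N.obj.proj g = M.proj g ∘ₗ N.carrier.subtype := by
    refine N.obj.hom_ext fun h x hx => ?_
    have hx' : (x : V) ∈ M.component h := hx
    by_cases hne : h = g
    · subst hne
      simp [proj_of_mem hx, proj_of_mem hx']
    · simp [proj_of_mem_ne hx hne, proj_of_mem_ne hx' hne]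
  exact LinearMap.congr_fun this x

theorem act_comm {g : G} {x : V} (hx : x ∈ M.component g) (e f : G) :
    M.act e (M.act f x) = (Φ.alt g e f : k) • M.act f (M.act e x) := by
  rw [M.act_act e f g x hx, M.act_act f e g x hx, smul_smul, mul_comm f e, Φ.slant_eq_alt_mul g e f,
    Units.val_mul]

theorem act_ne_zero {x : V} {g : G} (hg : x ∈ M.component g) (hx : x ≠ 0) (e : G) :
    M.act e x ≠ 0 := by
  intro h
  have := M.act_act e⁻¹ e g x hg
  rw [h, map_zero, inv_mul_cancel, M.act_one] at this
  exact hx ((smul_eq_zero.1 this.symm).resolve_left (Units.ne_zero _))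

/-- A joint eigenvector of `e ▷ -` and `f ▷ -` in `V_g` forces the commutator of the two operators on
`V_g` to be trivial. -/
theorem alt_eq_one_of_eigenvector {g e f : G} {x : V} (hg : x ∈ M.component g) (hx : x ≠ 0)
    {a b : k} (he : M.act e x = a • x) (hf : M.act f x = b • x) : Φ.alt g e f = 1 := by
  have h := act_comm hg e f
  have h0 : M.act f (M.act e x) ≠ 0 := act_ne_zero (M.act_mem _ _ _ hg) (act_ne_zero hg hx e) f
  rw [show M.act e (M.act f x) = M.act f (M.act e x) by
    rw [he, hf, map_smul, map_smul, he, hf, smul_comm]] at h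
  have h1 : ((Φ.alt g e f : k) - 1) • M.act f (M.act e x) = 0 := by
    rw [sub_smul, one_smul, ← h, sub_self]
  exact Units.ext (sub_eq_zero.1 ((smul_eq_zero.1 h1).resolve_right h0))

/-- The support of a twisted Yetter-Drinfeld module: the degrees of its nonzero homogeneous
elements. -/
def support (M : TwistedYD Φ V) : Set G := {g | M.component g ≠ ⊥}

theorem mem_support_iff {g : G} : g ∈ M.support ↔ ∃ x ∈ M.component g, x ≠ 0 :=
  Submodule.ne_bot_iff _

theorem mem_support_obj_iff {N : M.Subobject} {g : G} :
    g ∈ N.obj.support ↔ ∃ x ∈ N.carrier, x ∈ M.component g ∧ x ≠ 0 := by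
  rw [mem_support_iff]
  constructor
  · rintro ⟨x, hx, h0⟩
    exact ⟨x, x.2, hx, by simpa using h0⟩
  · rintro ⟨x, hN, hx, h0⟩
    exact ⟨⟨x, hN⟩, hx, fun h => h0 (congrArg Subtype.val h)⟩

/-! ### Diagonal objects -/

/-- Every degree in the support is attained in a given homogeneous basis. -/
theorem exists_mem_component_of_mem_support {n : ℕ} (X : Module.Basis (Fin n) k V)
    (hX : ∀ i, ∃ g, X i ∈ M.component g) {g : G} (hg : g ∈ M.support) :
    ∃ i, X i ∈ M.component g := by
  obtain ⟨x, hx, h0⟩ := mem_support_iff.1 hg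
  by_contra! h
  have hp : M.proj g = 0 := X.ext fun i => by
    obtain ⟨d, hd⟩ := hX i
    exact proj_of_mem_ne hd fun hdg => h i (hdg ▸ hd)
  exact h0 (by rw [← proj_of_mem hx, hp, LinearMap.zero_apply])

theorem alt_eq_one_of_isDiagonal (hM : M.IsDiagonal) {g e f : G} (hg : g ∈ M.support)
    (he : e ∈ M.support) (hf : f ∈ M.support) : Φ.alt g e f = 1 := by
  obtain ⟨n, X, q, hX, hq⟩ := hM
  have key : ∀ {e : G}, e ∈ M.support → ∀ j, ∃ a : k, M.act e (X j) = a • X j := by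
    intro e he j
    obtain ⟨i, hi⟩ := exists_mem_component_of_mem_support X hX he
    refine ⟨q i j, ?_⟩
    have h := hq i j
    rw [M.braiding_tmul hi] at h
    -- `(e ▷ X j) ⊗ X i = q i j • (X j ⊗ X i)`, contracted with the coordinate form of `X i`
    have h' := congrArg (TensorProduct.rid k V ∘ (X.coord i).lTensor V) h
    simpa using h'
  obtain ⟨i, hi⟩ := exists_mem_component_of_mem_support X hX hg
  obtain ⟨a, ha⟩ := key he i
  obtain ⟨b, hb⟩ := key hf i
  exact alt_eq_one_of_eigenvector hi (X.ne_zero i) ha hb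

end TwistedYD

theorem Module.End.span_joint_eigenvectors_eq_top {k : Type*} [Field k] [IsAlgClosed k]
    {W : Type*} [AddCommGroup W] [Module k W] [FiniteDimensional k W] {ι : Type*}
    (φ : ι → Module.End k W) (hcomm : ∀ i j, Commute (φ i) (φ j))
    (hss : ∀ i, (φ i).IsSemisimple) :
    Submodule.span k {x | ∀ i, ∃ a : k, φ i x = a • x} = ⊤ := by
  rw [eq_top_iff, ← iSup_iInf_maxGenEigenspace_eq_top_of_iSup_maxGenEigenspace_eq_top_of_commute φ
    (fun i j _ => hcomm i j) fun i => iSup_maxGenEigenspace_eq_top _]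
  refine iSup_le fun χ x hx => Submodule.subset_span fun i => ⟨χ i, ?_⟩
  rw [Submodule.mem_iInf] at hx
  have := hx i
  rwa [(hss i).isFinitelySemisimple.maxGenEigenspace_eq_eigenspace, mem_eigenspace_iff] at this

theorem Module.End.isSemisimple_of_pow_eq_smul_one {k : Type*} [Field k] [CharZero k]
    {W : Type*} [AddCommGroup W] [Module k W] {φ : Module.End k W} {n : ℕ} (hn : n ≠ 0) {c : k}
    (hc : c ≠ 0) (h : φ ^ n = c • 1) : φ.IsSemisimple := by
  refine isSemisimple_of_squarefree_aeval_eq_zero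
    (Polynomial.separable_X_pow_sub_C c (Nat.cast_ne_zero.2 hn) hc).squarefree ?_
  simp [h, Algebra.algebraMap_eq_smul_one]

namespace TwistedYD

variable {k : Type u} [Field k] {G : Type v} [CommGroup G] {Φ : NormalizedThreeCocycle k G}
  {V : Type w} [AddCommGroup V] [Module k V] {M : TwistedYD Φ V}

/-- On each homogeneous component, `(e ▷ -) ^ n` agrees with `e ^ n ▷ -` up to a nonzero scalar. -/
theorem exists_act_pow (M : TwistedYD Φ V) (g e : G) (n : ℕ) :
    ∃ c : kˣ, ∀ x ∈ M.component g, (M.act e ^ n) x = (c : k) • M.act (e ^ n) x := by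
  induction n with
  | zero => exact ⟨1, fun x _ => by simp [M.act_one]⟩
  | succ n ih =>
    obtain ⟨c, hc⟩ := ih
    refine ⟨c * Φ.slant g e (e ^ n), fun x hx => ?_⟩
    rw [pow_succ', Module.End.mul_apply, hc x hx, map_smul, M.act_act e _ g x hx, smul_smul,
      Units.val_mul, pow_succ']

/-- The restriction of the operator `e ▷ -` to the homogeneous component `V_g`. -/
def actOn (M : TwistedYD Φ V) (g e : G) : Module.End k (M.component g) :=
  (M.act e).restrict (M.act_mem e g)

@[simp]
theorem coe_actOn (g e : G) (x : M.component g) : (M.actOn g e x : V) = M.act e x := rfl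

theorem isSemisimple_actOn [CharZero k] [Finite G] (g e : G) : (M.actOn g e).IsSemisimple := by
  obtain ⟨c, hc⟩ := M.exists_act_pow g e (orderOf e)
  refine Module.End.isSemisimple_of_pow_eq_smul_one (orderOf_pos e).ne' c.ne_zero ?_
  ext x
  have h : ∀ n : ℕ, ((M.actOn g e ^ n) x : V) = (M.act e ^ n) x := by
    intro n
    induction n with
    | zero => rfl
    | succ n ih =>
      rw [pow_succ', pow_succ', Module.End.mul_apply, Module.End.mul_apply, coe_actOn, ih]
  rw [h, hc x x.2, pow_orderOf_eq_one, M.act_one]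
  rfl

theorem isDiagonal_of_alt_eq_one [IsAlgClosed k] [CharZero k] [Finite G] [Module.Finite k V]
    (h : ∀ g ∈ M.support, ∀ e ∈ M.support, ∀ f ∈ M.support, Φ.alt g e f = 1) :
    M.IsDiagonal := by
  let T : Set V := {x | (∃ g, x ∈ M.component g) ∧ ∀ e ∈ M.support, ∃ a : k, M.act e x = a • x}
  have hT : ⊤ ≤ Submodule.span k T := by
    rw [← M.iSup_component]
    refine iSup_le fun g => ?_
    by_cases hg : g ∈ M.support
    · have key := Module.End.span_joint_eigenvectors_eq_top
        (fun e : M.support => M.actOn g e) (fun e f => ?_) fun e => isSemisimple_actOn g e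
      · rw [← (M.component g).range_subtype, LinearMap.range_eq_map, ← key, Submodule.map_span,
          Submodule.span_le]
        rintro _ ⟨x, hx, rfl⟩
        refine Submodule.subset_span ⟨⟨g, x.2⟩, fun e he => ?_⟩
        obtain ⟨a, ha⟩ := hx ⟨e, he⟩
        exact ⟨a, congrArg Subtype.val ha⟩
      · ext x
        have := act_comm x.2 e.1 f.1
        rwa [h g hg e e.2 f f.2, Units.val_one, one_smul] at this
    · rw [show M.component g = ⊥ from not_not.1 hg]
      exact bot_le
  let B := Module.Basis.ofSpan hT
  have hB : ∀ i, B i ∈ T := fun i => Module.Basis.ofSpan_subset hT ⟨i, rfl⟩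
  have := Module.Finite.finite_basis B
  let X := B.reindex (Finite.equivFin _)
  have hX : ∀ i, X i ∈ T := fun i => by
    rw [Module.Basis.reindex_apply]
    exact hB _
  have hq : ∀ i j, ∃ q : kˣ, M.braiding (X i ⊗ₜ[k] X j) = (q : k) • (X j ⊗ₜ[k] X i) := by
    intro i j
    obtain ⟨d, hd⟩ := (hX i).1
    obtain ⟨d', hd'⟩ := (hX j).1
    obtain ⟨a, ha⟩ := (hX j).2 d (mem_support_iff.2 ⟨X i, hd, X.ne_zero i⟩)
    have ha0 : a ≠ 0 := by
      rintro rfl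
      exact act_ne_zero hd' (X.ne_zero j) d (by rw [ha, zero_smul])
    exact ⟨Units.mk0 a ha0, by rw [M.braiding_tmul hd, ha, TensorProduct.smul_tmul']; rfl⟩
  choose q hq using hq
  exact ⟨_, X, q, fun i => (hX i).1, hq⟩

theorem isDiagonal_iff [IsAlgClosed k] [CharZero k] [Finite G] [Module.Finite k V] :
    M.IsDiagonal ↔ ∀ g ∈ M.support, ∀ e ∈ M.support, ∀ f ∈ M.support, Φ.alt g e f = 1 :=
  ⟨fun h _ hg _ he _ hf => alt_eq_one_of_isDiagonal h hg he hf, isDiagonal_of_alt_eq_one⟩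

/-! ### Simple objects and abelian cocycles -/

/-- In an object concentrated in one degree, every stable subspace is a subobject. -/
def HasDegree.subobject {g : G} (hg : M.HasDegree g) (P : Submodule k V)
    (hP : ∀ e, ∀ x ∈ P, M.act e x ∈ P) : M.Subobject where
  carrier := P
  proj_mem h x hx := by
    have hxg : x ∈ M.component g := hg ▸ Submodule.mem_top
    by_cases hgh : g = h
    · rwa [← hgh, proj_of_mem hxg]
    · rw [proj_of_mem_ne hxg hgh]
      exact P.zero_mem
  act_mem e x hx := hP e x hx

/-- A homogeneous component, as a subobject. -/
def componentSubobject (M : TwistedYD Φ V) (g : G) : M.Subobject where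
  carrier := M.component g
  proj_mem h x hx := by
    by_cases hgh : g = h
    · rw [← hgh]
      exact M.proj_mem g x
    · rw [proj_of_mem_ne hx hgh]
      exact Submodule.zero_mem _
  act_mem e x hx := M.act_mem e g x hx

theorem IsSimple.exists_hasDegree (hM : M.IsSimple) : ∃ g, M.HasDegree g := by
  by_contra! h
  have hbot : ∀ g, M.component g = ⊥ := fun g =>
    (hM.2 (M.componentSubobject g)).resolve_right (h g)
  have hV : (⊥ : Submodule k V) = ⊤ := by
    rw [← M.iSup_component]
    simp [hbot]
  have := hM.1
  exact bot_ne_top hV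

/-- A simple object is spanned by the orbit of any nonzero vector. -/
theorem IsSimple.finite [Finite G] (hM : M.IsSimple) : Module.Finite k V := by
  obtain ⟨g, hg⟩ := hM.exists_hasDegree
  have := hM.1
  obtain ⟨x, hx⟩ := exists_ne (0 : V)
  have hxg : x ∈ M.component g := hg ▸ Submodule.mem_top
  let N := hg.subobject (Submodule.span k (Set.range fun e => M.act e x)) fun f y hy => by
    induction hy using Submodule.span_induction with
    | mem y hy =>
      obtain ⟨e, rfl⟩ := hy
      rw [M.act_act f e g x hxg]
      exact Submodule.smul_mem _ _ (Submodule.subset_span ⟨f * e, rfl⟩)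
    | zero => simp
    | add y z _ _ hy hz => rw [map_add]; exact Submodule.add_mem _ hy hz
    | smul a y _ hy => rw [map_smul]; exact Submodule.smul_mem _ _ hy
  have hxN : x ∈ N.carrier := Submodule.subset_span ⟨1, M.act_one x⟩
  have htop : N.carrier = ⊤ := (hM.2 N).resolve_left fun h => hx (by
    rwa [h, Submodule.mem_bot] at hxN)
  exact ⟨Submodule.fg_def.2 ⟨_, Set.finite_range _, htop⟩⟩

/-- Schur's lemma: if the operators `e ▷ -` commute, each of them is a scalar, so that every line is a
subobject. -/
theorem IsSimple.finrank_eq_one [IsAlgClosed k] [Module.Finite k V] (hM : M.IsSimple) {g : G}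
    (hg : M.HasDegree g) (h : ∀ e f, Φ.alt g e f = 1) : Module.finrank k V = 1 := by
  have := hM.1
  have hmem (x : V) : x ∈ M.component g := hg ▸ Submodule.mem_top
  have hscalar : ∀ e, ∃ a : k, ∀ x, M.act e x = a • x := by
    intro e
    obtain ⟨a, ha⟩ := Module.End.exists_eigenvalue (M.act e)
    let N := hg.subobject (Module.End.eigenspace (M.act e) a) fun f x hx => by
      rw [Module.End.mem_eigenspace_iff] at hx ⊢
      rw [act_comm (hmem x), h, Units.val_one, one_smul, hx, map_smul]
    have htop : N.carrier = ⊤ := (hM.2 N).resolve_left ha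
    exact ⟨a, fun x => Module.End.mem_eigenspace_iff.1 (htop ▸ Submodule.mem_top : x ∈ N.carrier)⟩
  obtain ⟨v, hv⟩ := exists_ne (0 : V)
  let N := hg.subobject (Submodule.span k {v}) fun e x hx => by
    obtain ⟨a, ha⟩ := hscalar e
    rw [ha]
    exact Submodule.smul_mem _ _ hx
  have htop : N.carrier = ⊤ :=
    (hM.2 N).resolve_left fun h => hv (Submodule.span_singleton_eq_bot.1 h)
  exact _root_.finrank_eq_one v hv fun x =>
    Submodule.mem_span_singleton.1 (htop ▸ Submodule.mem_top : x ∈ N.carrier)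

open Classical in
/-- The twisted Yetter-Drinfeld module concentrated in degree `g` that is given by a projective
representation with `2`-cocycle `Φ_g`. -/
noncomputable def ofProjectiveRep {W : Type*} [AddCommGroup W] [Module k W] (g : G)
    (ρ : G → W →ₗ[k] W) (h1 : ∀ x, ρ 1 x = x)
    (hρ : ∀ e f x, ρ e (ρ f x) = (Φ.slant g e f : k) • ρ (e * f) x) : TwistedYD Φ W where
  component h := if h = g then ⊤ else ⊥
  isInternal := by
    rw [DirectSum.isInternal_submodule_iff_iSupIndep_and_iSup_eq_top]
    refine ⟨?_, eq_top_iff.2 (le_iSup_of_le g (by simp))⟩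
    intro h
    by_cases hh : h = g
    · subst hh
      refine disjoint_bot_right.mono_right (iSup₂_le fun j hj => ?_)
      simp [hj]
    · simp [hh]
  act := ρ
  act_mem e h x hx := by
    by_cases hh : h = g
    · simp [hh]
    · simp only [hh, if_false, Submodule.mem_bot] at hx ⊢
      rw [hx, map_zero]
  act_one := h1
  act_act e f h x hx := by
    by_cases hh : h = g
    · subst hh
      exact hρ e f x
    · simp only [hh, if_false, Submodule.mem_bot] at hx
      simp [hx]

theorem ofProjectiveRep_hasDegree {W : Type*} [AddCommGroup W] [Module k W] (g : G)
    (ρ : G → W →ₗ[k] W) (h1 : ∀ x, ρ 1 x = x)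
    (hρ : ∀ e f x, ρ e (ρ f x) = (Φ.slant g e f : k) • ρ (e * f) x) :
    (ofProjectiveRep g ρ h1 hρ).HasDegree g := by
  simp [HasDegree, ofProjectiveRep]

end TwistedYD

namespace NormalizedThreeCocycle

variable {k : Type u} [Field k] {G : Type v} [CommGroup G] {Φ : NormalizedThreeCocycle k G}

open TwistedYD

theorem isAbelian_of_alt_eq_one [IsAlgClosed k] [Finite G] (h : ∀ g e f, Φ.alt g e f = 1) :
    Φ.IsAbelian := by
  intro V _ _ M hM
  have := hM.finite
  obtain ⟨g, hg⟩ := hM.exists_hasDegree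
  exact hM.finrank_eq_one hg (h g)

/-- If `Φ` is abelian, all operators of a nonzero finite-dimensional projective representation with
`2`-cocycle `Φ_g` have a joint eigenvector, since a minimal stable subspace is a line. -/
theorem IsAbelian.alt_eq_one (hΦ : Φ.IsAbelian) {W : Type w} [AddCommGroup W] [Module k W]
    [Module.Finite k W] [Nontrivial W] {g : G} (ρ : G → W →ₗ[k] W) (h1 : ∀ x, ρ 1 x = x)
    (hρ : ∀ e f x, ρ e (ρ f x) = (Φ.slant g e f : k) • ρ (e * f) x) (e f : G) :
    Φ.alt g e f = 1 := by
  obtain ⟨P, ⟨hP0, hP⟩, hmin⟩ := exists_minimal_of_wellFoundedLT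
    (fun P : Submodule k W => P ≠ ⊥ ∧ ∀ e, ∀ x ∈ P, ρ e x ∈ P) ⟨⊤, top_ne_bot, by simp⟩
  have hPn : Nontrivial P := Submodule.nontrivial_iff_ne_bot.2 hP0
  -- `P` is moved to the universe of `k`, where `IsAbelian` quantifies over the simple objects.
  let L : P ≃ₗ[k] (Fin (Module.finrank k P) → k) := (Module.finBasis k P).equivFun
  let σ (e : G) : P →ₗ[k] P := (ρ e).restrict (hP e)
  have hσ (e f x) : σ e (σ f x) = (Φ.slant g e f : k) • σ (e * f) x := Subtype.ext (hρ e f x)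
  let M := ofProjectiveRep (Φ := Φ) g (fun e => L.conj (σ e))
    (fun x => by
      rw [LinearEquiv.conj_apply_apply, show σ 1 = LinearMap.id from
        LinearMap.ext fun x => Subtype.ext (h1 x)]
      simp)
    (fun e f x => by simp [LinearEquiv.conj_apply_apply, hσ])
  have hM : M.HasDegree g := ofProjectiveRep_hasDegree _ _ _ _
  have hMact (e x) : M.act e (L x) = L (σ e x) := by
    change L.conj (σ e) (L x) = _
    rw [LinearEquiv.conj_apply_apply, L.symm_apply_apply]
  have hsimple : M.IsSimple := by
    refine ⟨L.symm.toEquiv.nontrivial, fun N => ?_⟩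
    by_cases hN : N.carrier = ⊥
    · exact Or.inl hN
    right
    obtain ⟨y, hy, hy0⟩ := (Submodule.ne_bot_iff _).1 hN
    let Q : Submodule k W := (N.carrier.comap L.toLinearMap).map P.subtype
    have hQ : P ≤ Q := by
      refine hmin ⟨?_, ?_⟩ (Submodule.map_subtype_le _ _)
      · refine (Submodule.ne_bot_iff _).2 ⟨L.symm y, ⟨L.symm y, by simpa using hy, rfl⟩, ?_⟩
        simpa using hy0
      · rintro e _ ⟨x, hx, rfl⟩
        refine ⟨σ e x, ?_, rfl⟩
        have := N.act_mem e _ hx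
        rwa [LinearEquiv.coe_coe, hMact] at this
    rw [eq_top_iff]
    rintro z -
    obtain ⟨x, hx, hxz⟩ := hQ (L.symm z).2
    rw [show x = L.symm z from Subtype.ext hxz] at hx
    simpa using hx
  obtain ⟨v, hv, hspan⟩ := finrank_eq_one_iff'.1 (hΦ _ M hsimple)
  obtain ⟨a, ha⟩ := hspan (M.act e v)
  obtain ⟨b, hb⟩ := hspan (M.act f v)
  exact alt_eq_one_of_eigenvector (hM ▸ Submodule.mem_top : v ∈ M.component g) hv ha.symm hb.symm

end NormalizedThreeCocycle

namespace TwistedYD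

variable {k : Type u} [Field k] {G : Type v} [CommGroup G] {Φ : NormalizedThreeCocycle k G}
  {V : Type w} [AddCommGroup V] [Module k V] {M : TwistedYD Φ V}

/-- The homogeneous component of degree `g ∈ H`, as a projective representation of `H`, witnesses
any nontrivial value of `alt` at `g`. -/
theorem alt_eq_one_of_isAbelian_restrict [Module.Finite k V] {H : Subgroup G}
    (hH : (Φ.restrict H).IsAbelian) {g e f : G} (hg : g ∈ M.support) (hgH : g ∈ H) (he : e ∈ H)
    (hf : f ∈ H) : Φ.alt g e f = 1 := by
  have : Nontrivial (M.component g) := Submodule.nontrivial_iff_ne_bot.2 hg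
  exact hH.alt_eq_one (g := ⟨g, hgH⟩) (fun e : H => M.actOn g e)
    (fun x => Subtype.ext (M.act_one x))
    (fun e f x => Subtype.ext (M.act_act e f g x x.2)) ⟨e, he⟩ ⟨f, hf⟩

/-! ### Decompositions into simple subobjects -/

variable {θ : ℕ} {S : Fin θ → M.Subobject}

theorem IsSimpleDecomposition.iSup_eq_top (hS : M.IsSimpleDecomposition S) :
    ⨆ i, (S i).carrier = ⊤ := by
  classical
  exact hS.2.submodule_iSup_eq_top

theorem IsSimpleDecomposition.finite [Finite G] (hS : M.IsSimpleDecomposition S) :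
    Module.Finite k V := by
  have (i : Fin θ) : Module.Finite k (S i).carrier := (hS.1 i).finite
  have := Submodule.finite_iSup fun i => (S i).carrier
  rw [hS.iSup_eq_top] at this
  exact Module.Finite.equiv Submodule.topEquiv

theorem le_component_of_hasDegree {N : M.Subobject} {g : G} (h : N.obj.HasDegree g) :
    N.carrier ≤ M.component g := Submodule.comap_subtype_eq_top.1 h

theorem IsSimpleDecomposition.exists_degree (hS : M.IsSimpleDecomposition S) :
    ∃ d : Fin θ → G, ∀ i, (S i).obj.HasDegree (d i) := by
  choose d hd using fun i => (hS.1 i).exists_hasDegree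
  exact ⟨d, hd⟩

theorem IsSimpleDecomposition.carrier_ne_bot (hS : M.IsSimpleDecomposition S) (i : Fin θ) :
    (S i).carrier ≠ ⊥ :=
  Submodule.nontrivial_iff_ne_bot.1 (hS.1 i).1

theorem IsSimpleDecomposition.support_eq_range (hS : M.IsSimpleDecomposition S) {d : Fin θ → G}
    (hd : ∀ i, (S i).obj.HasDegree (d i)) : M.support = Set.range d := by
  ext g
  constructor
  · intro hg
    obtain ⟨x, hx, h0⟩ := mem_support_iff.1 hg
    by_contra! h
    have hle : (⊤ : Submodule k V) ≤ LinearMap.ker (M.proj g) := by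
      rw [← hS.iSup_eq_top]
      exact iSup_le fun i y hy =>
        proj_of_mem_ne (le_component_of_hasDegree (hd i) hy) fun h' => h ⟨i, h'⟩
    exact h0 ((proj_of_mem hx).symm.trans (hle Submodule.mem_top))
  · rintro ⟨i, rfl⟩
    exact fun h => hS.carrier_ne_bot i (le_bot_iff.1 (h ▸ le_component_of_hasDegree (hd i)))

theorem IsSimpleDecomposition.supportGroup_eq (hS : M.IsSimpleDecomposition S) :
    M.supportGroup S = Subgroup.closure M.support := by
  obtain ⟨d, hd⟩ := hS.exists_degree
  rw [supportGroup, hS.support_eq_range hd]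
  congr 1
  ext g
  constructor
  · rintro ⟨i, hi⟩
    obtain ⟨x, hx, h0⟩ := (Submodule.ne_bot_iff _).1 (hS.carrier_ne_bot i)
    exact ⟨i, eq_of_mem_component (le_component_of_hasDegree (hd i) hx)
      (le_component_of_hasDegree hi hx) h0⟩
  · rintro ⟨i, rfl⟩
    exact ⟨i, hd i⟩

/-- If the simple summands have distinct degrees, they are the homogeneous components. -/
theorem IsSimpleDecomposition.component_le (hS : M.IsSimpleDecomposition S) {d : Fin θ → G}
    (hd : ∀ i, (S i).obj.HasDegree (d i)) (hinj : Function.Injective d) (i : Fin θ) :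
    M.component (d i) ≤ (S i).carrier := by
  intro x hx
  have hle : (⊤ : Submodule k V) ≤ (S i).carrier.comap (M.proj (d i)) := by
    rw [← hS.iSup_eq_top]
    refine iSup_le fun j y hy => ?_
    have hyj := le_component_of_hasDegree (hd j) hy
    rw [Submodule.mem_comap]
    by_cases hij : j = i
    · subst hij
      rwa [proj_of_mem hyj]
    · rw [proj_of_mem_ne hyj fun h => hij (hinj h)]
      exact Submodule.zero_mem _
  have : M.proj (d i) x ∈ (S i).carrier := hle Submodule.mem_top
  rwa [proj_of_mem hx] at this

/-- The intersection of two subobjects, as a subobject of the second. -/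
def Subobject.inter (N S : M.Subobject) : S.obj.Subobject where
  carrier := N.carrier.comap S.carrier.subtype
  proj_mem g x hx := by
    change (S.obj.proj g x : V) ∈ N.carrier
    rw [coe_obj_proj]
    exact N.proj_mem g x hx
  act_mem e x hx := N.act_mem e x hx

/-- A subobject that meets a simple one nontrivially contains it. -/
theorem Subobject.le_of_isSimple {N S : M.Subobject} (hS : S.obj.IsSimple) {x : V}
    (hxN : x ∈ N.carrier) (hxS : x ∈ S.carrier) (hx : x ≠ 0) : S.carrier ≤ N.carrier := by
  refine Submodule.comap_subtype_eq_top.1 ((hS.2 (N.inter S)).resolve_left fun h => hx ?_)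
  have : (⟨x, hxS⟩ : S.carrier) ∈ (N.inter S).carrier := hxN
  rw [h, Submodule.mem_bot] at this
  exact congrArg Subtype.val this

/-- The sum of the subobjects `S i` for `i ∈ s`. -/
def Subobject.sum {ι : Type*} (S : ι → M.Subobject) (s : Set ι) : M.Subobject where
  carrier := ⨆ i ∈ s, (S i).carrier
  proj_mem g x hx := by
    have : ⨆ i ∈ s, (S i).carrier ≤ (⨆ i ∈ s, (S i).carrier).comap (M.proj g) :=
      iSup₂_le fun i hi y hy => le_iSup₂_of_le (f := fun i (_ : i ∈ s) => (S i).carrier) i hi le_rfl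
        ((S i).proj_mem g y hy)
    exact this hx
  act_mem e x hx := by
    have : ⨆ i ∈ s, (S i).carrier ≤ (⨆ i ∈ s, (S i).carrier).comap (M.act e) :=
      iSup₂_le fun i hi y hy => le_iSup₂_of_le (f := fun i (_ : i ∈ s) => (S i).carrier) i hi le_rfl
        ((S i).act_mem e y hy)
    exact this hx

/-- By independence, a partial sum of the simple summands is proper. -/
theorem IsSimpleDecomposition.eq_univ_of_sum_eq_top (hS : M.IsSimpleDecomposition S)
    {s : Set (Fin θ)} (hs : (Subobject.sum S s).carrier = ⊤) : s = Set.univ := by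
  classical
  rw [Set.eq_univ_iff_forall]
  intro m
  by_contra hm
  have hdis := hS.2.submodule_iSupIndep m
  have hle : (Subobject.sum S s).carrier ≤ ⨆ j, ⨆ (_ : j ≠ m), (S j).carrier :=
    iSup₂_le fun i hi => le_iSup₂_of_le (f := fun j (_ : j ≠ m) => (S j).carrier) i
      (fun h => hm (h ▸ hi)) le_rfl
  rw [hs, top_le_iff] at hle
  rw [hle, disjoint_top] at hdis
  exact hS.carrier_ne_bot m hdis

/-- Three simple summands in whose degrees `alt` is nontrivial have a nondiagonal sum. -/
theorem IsSimpleDecomposition.eq_three [IsAlgClosed k] [CharZero k] [Finite G]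
    (hS : M.IsSimpleDecomposition S) (hM : M.IsMinimalNondiagonal) : θ = 3 := by
  have := hS.finite
  obtain ⟨d, hd⟩ := hS.exists_degree
  have hnd := hM.1
  rw [isDiagonal_iff, hS.support_eq_range hd] at hnd
  push Not at hnd
  obtain ⟨_, ⟨i, rfl⟩, _, ⟨j, rfl⟩, _, ⟨l, rfl⟩, h⟩ := hnd
  let N := Subobject.sum S {i, j, l}
  have hle : ∀ m ∈ ({i, j, l} : Set (Fin θ)), (S m).carrier ≤ N.carrier := fun m hm =>
    le_iSup₂_of_le (f := fun m (_ : m ∈ ({i, j, l} : Set (Fin θ))) => (S m).carrier) m hm le_rfl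
  have hsupp : ∀ m ∈ ({i, j, l} : Set (Fin θ)), d m ∈ N.obj.support := by
    intro m hm
    obtain ⟨x, hx, h0⟩ := (Submodule.ne_bot_iff _).1 (hS.carrier_ne_bot m)
    exact mem_support_obj_iff.2 ⟨x, hle m hm hx, le_component_of_hasDegree (hd m) hx, h0⟩
  have hN : N.carrier = ⊤ := by
    by_contra hN
    have hbot : N.carrier ≠ ⊥ := fun hN =>
      hS.carrier_ne_bot i (le_bot_iff.1 (hN ▸ hle i (by simp)))
    exact h (alt_eq_one_of_isDiagonal (hM.2 N hbot hN) (hsupp i (by simp)) (hsupp j (by simp))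
      (hsupp l (by simp)))
  have huniv := hS.eq_univ_of_sum_eq_top hN
  obtain ⟨hij, hil, hjl⟩ := NormalizedThreeCocycle.ne_of_alt_ne_one h
  have hcard := Set.ncard_eq_three.2 ⟨i, j, l, ne_of_apply_ne d hij, ne_of_apply_ne d hil,
    ne_of_apply_ne d hjl, rfl⟩
  rwa [huniv, Set.ncard_univ, Nat.card_eq_fintype_card, Fintype.card_fin] at hcard

theorem IsSimpleDecomposition.isAbelian_of_isDiagonal [IsAlgClosed k] [Finite G]
    (hS : M.IsSimpleDecomposition S) (hM : M.IsDiagonal) :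
    (Φ.restrict (M.supportGroup S)).IsAbelian := by
  refine NormalizedThreeCocycle.isAbelian_of_alt_eq_one fun g e f => ?_
  have h := hS.supportGroup_eq
  exact Φ.alt_eq_one_of_mem_closure
    (fun g hg e he f hf => alt_eq_one_of_isDiagonal hM hg he hf) (h ▸ g.2) (h ▸ e.2) (h ▸ f.2)

theorem IsSimpleDecomposition.isDiagonal_of_isAbelian [IsAlgClosed k] [CharZero k] [Finite G]
    (hS : M.IsSimpleDecomposition S) (h : (Φ.restrict (M.supportGroup S)).IsAbelian) :
    M.IsDiagonal := by
  have := hS.finite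
  have hsub : M.support ⊆ M.supportGroup S := hS.supportGroup_eq ▸ Subgroup.subset_closure
  exact isDiagonal_of_alt_eq_one fun g hg e he f hf =>
    alt_eq_one_of_isAbelian_restrict h hg (hsub hg) (hsub he) (hsub hf)

/-- An object of rank `3` has no nondiagonal proper subobject: the support of a nondiagonal subobject
has three elements, so that the three simple summands have distinct degrees and all meet it. -/
theorem IsSimpleDecomposition.eq_top_of_not_isDiagonal [IsAlgClosed k] [CharZero k] [Finite G]
    {S : Fin 3 → M.Subobject} (hS : M.IsSimpleDecomposition S) {N : M.Subobject}
    (hN : ¬ N.obj.IsDiagonal) : N.carrier = ⊤ := by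
  have := hS.finite
  obtain ⟨d, hd⟩ := hS.exists_degree
  rw [isDiagonal_iff] at hN
  push Not at hN
  obtain ⟨g, hg, e, he, f, hf, h⟩ := hN
  have hsub : N.obj.support ⊆ Set.range d := by
    rw [← hS.support_eq_range hd]
    intro g hg
    obtain ⟨x, -, hx, h0⟩ := mem_support_obj_iff.1 hg
    exact mem_support_iff.2 ⟨x, hx, h0⟩
  obtain ⟨hge, hgf, hef⟩ := NormalizedThreeCocycle.ne_of_alt_ne_one h
  have hthree : ({g, e, f} : Set G).ncard = 3 :=
    Set.ncard_eq_three.2 ⟨g, e, f, hge, hgf, hef, rfl⟩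
  have hrange : (Set.range d).ncard ≤ 3 := by
    rw [← Set.image_univ]
    exact (Set.ncard_image_le).trans (by simp)
  have hgefN : ({g, e, f} : Set G) ⊆ N.obj.support := by
    simp [Set.insert_subset_iff, hg, he, hf]
  have heq : ({g, e, f} : Set G) = Set.range d :=
    Set.eq_of_subset_of_ncard_le (hgefN.trans hsub) (hrange.trans hthree.ge)
  have hinj : Function.Injective d := by
    rw [← Set.injOn_univ]
    refine Set.injOn_of_ncard_image_eq ?_
    rw [Set.image_univ, ← heq, hthree]
    simp
  rw [eq_top_iff, ← hS.iSup_eq_top]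
  refine iSup_le fun i => ?_
  have hi : d i ∈ ({g, e, f} : Set G) := heq ▸ ⟨i, rfl⟩
  obtain ⟨x, hxN, hx, h0⟩ := mem_support_obj_iff.1 (hgefN hi)
  exact Subobject.le_of_isSimple (hS.1 i) hxN (hS.component_le hd hinj i hx) h0

end TwistedYD

/-! ### Minimal nondiagonal objects -/

theorem proposition5p4 {k : Type u} [Field k] [IsAlgClosed k] [CharZero k]
    {G : Type v} [CommGroup G] [Finite G] (Φ : NormalizedThreeCocycle k G)
    {V : Type w} [AddCommGroup V] [Module k V] (M : TwistedYD Φ V)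
    (θ : ℕ) (S : Fin θ → M.Subobject) (hS : M.IsSimpleDecomposition S) :
    M.IsMinimalNondiagonal ↔ θ = 3 ∧ ¬ (Φ.restrict (M.supportGroup S)).IsAbelian := by
  constructor
  · intro hM
    exact ⟨hS.eq_three hM, fun h => hM.1 (hS.isDiagonal_of_isAbelian h)⟩
  · rintro ⟨rfl, h⟩
    refine ⟨fun hM => h (hS.isAbelian_of_isDiagonal hM), fun N _ hN => ?_⟩
    by_contra hN'
    exact hN (hS.eq_top_of_not_isDiagonal hN')
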